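/- Let $G=(V,E)$ be a connected simple graph with $V\neq\emptyset$ (possibly infinite), regarded as a geodesic metric space in which every edge is isometric to $[0,1]$ and the distance between two points (vertices or interior points of edges) is the length of a shortest path joining them. A geodesic triangle $T$ in $G$ is the union of three geodesics $[xy],[yz],[zx]$; for $\delta\ge 0$, it is $\delta$-thin if each of its sides is contained in the $\delta$-neighborhood of the union of the other two. Let $\delta(T)=\inf\{\delta\ge 0 : T\text{ is }\delta\text{-thin}\}$, and let $\delta(G)=\sup\{\delta(T) : T\text{ is a geodesic triangle in }G\}\in[0,\infty]$ be the hyperbolicity constant of $G$. Let $c(G)\in[0,\infty]$, the circumference of $G$, be the supremum of the lengths of the cycles in $G$ (with $c(G)=0$ if $G$ has no cycles). If every edge of $G$ belongs to at most one cycle, then $$\delta(G)=\frac14\,c(G).$$ -/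

import Mathlib

open scoped NNReal ENNReal

/-! ### Gromov hyperbolicity of a metric space -/

section Hyperbolicity

variable {X : Type*} [MetricSpace X]

/-- `S` is (the image of) a geodesic joining `x` and `y`, parametrized by arc length. -/
def IsGeodesicSegment (x y : X) (S : Set X) : Prop :=
  ∃ γ : ℝ → X, γ 0 = x ∧ γ (dist x y) = y ∧
    (∀ s ∈ Set.Icc 0 (dist x y), ∀ t ∈ Set.Icc 0 (dist x y), dist (γ s) (γ t) = |s - t|) ∧
    S = γ '' Set.Icc 0 (dist x y)

/-- A triangle with sides `A`, `B`, `C` is `δ`-thin if each side is contained in the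
(closed) `δ`-neighborhood of the union of the other two. -/
def IsThinTriangle (δ : ℝ≥0) (A B C : Set X) : Prop :=
  A ⊆ Metric.cthickening δ (B ∪ C) ∧
  B ⊆ Metric.cthickening δ (C ∪ A) ∧
  C ⊆ Metric.cthickening δ (A ∪ B)

/-- The sharp thin constant `δ(T)` of the triangle with sides `A`, `B`, `C`. -/
noncomputable def thinConstant (A B C : Set X) : ℝ≥0∞ :=
  ⨅ (δ : ℝ≥0) (_ : IsThinTriangle δ A B C), (δ : ℝ≥0∞)

variable (X) in
/-- The sharp hyperbolicity constant `δ(X)`: the supremum of `δ(T)` over all geodesic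
triangles `T` in `X`; it is `∞` if `X` is not hyperbolic. -/
noncomputable def hyperbolicityConstant : ℝ≥0∞ :=
  ⨆ (x : X) (y : X) (z : X) (A : Set X) (B : Set X) (C : Set X)
    (_ : IsGeodesicSegment x y A) (_ : IsGeodesicSegment y z B) (_ : IsGeodesicSegment z x C),
    thinConstant A B C

end Hyperbolicity

/-! ### A connected graph as a metric graph with edges of length one -/

namespace MetricGraph

variable {V : Type*}

/-- A representative of a point of the metric graph of the connected graph `G`: either the point
of the edge `[fst, snd]` at distance `pos` from `fst` (and `1 - pos` from `snd`), or
a vertex `fst = snd` (with `pos = 0`). Distinct representatives may describe the same point. -/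
structure Rep (G : SimpleGraph V) (hG : G.Connected) where
  fst : V
  snd : V
  pos : ℝ
  valid : (G.Adj fst snd ∧ 0 ≤ pos ∧ pos ≤ 1) ∨ (fst = snd ∧ pos = 0)

namespace Rep

variable {G : SimpleGraph V} {hG : G.Connected}

/-- The distance from a point to a vertex `w`: the shorter of the routes that leave the edge
of the point through its two ends. -/
noncomputable def distVertex (p : Rep G hG) (w : V) : ℝ :=
  min (p.pos + G.dist p.fst w) ((1 - p.pos) + G.dist p.snd w)

/-- The length of a shortest route from `p` to `q` that passes through an end of the edge of `p`
and an end of the edge of `q`. -/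
noncomputable def distThrough (p q : Rep G hG) : ℝ :=
  min (p.distVertex q.fst + q.pos) (p.distVertex q.snd + (1 - q.pos))

open Classical in
/-- The length of a shortest path between two points: either a path through ends of their edges,
or, if both lie on the same edge (oriented equally or oppositely), the segment of that edge. -/
noncomputable def pathDist (p q : Rep G hG) : ℝ :=
  if p.fst = q.fst ∧ p.snd = q.snd then min |p.pos - q.pos| (distThrough p q)
  else if p.fst = q.snd ∧ p.snd = q.fst then min |p.pos - (1 - q.pos)| (distThrough p q)
  else distThrough p q

theorem pos_nonneg (p : Rep G hG) : 0 ≤ p.pos := by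
  rcases p.valid with h | h
  · exact h.2.1
  · exact h.2.ge

theorem pos_le_one (p : Rep G hG) : p.pos ≤ 1 := by
  rcases p.valid with h | h
  · exact h.2.2
  · rw [h.2]; exact zero_le_one

theorem dist_tri (hG : G.Connected) (u v w : V) :
    (G.dist u w : ℝ) ≤ G.dist u v + G.dist v w := by
  exact_mod_cast hG.dist_triangle

theorem dist_ends_le (p : Rep G hG) : (G.dist p.fst p.snd : ℝ) ≤ 1 := by
  rcases p.valid with h | h
  · rw [SimpleGraph.dist_eq_one_iff_adj.mpr h.1]; simp
  · rw [h.1]; simp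

theorem distThrough_comm (p q : Rep G hG) : distThrough p q = distThrough q p := by
  unfold distThrough distVertex
  rw [G.dist_comm (u := q.fst) (v := p.fst), G.dist_comm (u := q.fst) (v := p.snd),
    G.dist_comm (u := q.snd) (v := p.fst), G.dist_comm (u := q.snd) (v := p.snd)]
  grind

theorem distThrough_nonneg (p q : Rep G hG) : 0 ≤ distThrough p q := by
  have := p.pos_nonneg
  have := p.pos_le_one
  have := q.pos_nonneg
  have := q.pos_le_one
  unfold distThrough distVertex
  refine le_min (add_nonneg (le_min ?_ ?_) ?_) (add_nonneg (le_min ?_ ?_) ?_) <;>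
    linarith

theorem pathDist_comm (p q : Rep G hG) : pathDist p q = pathDist q p := by
  have h := distThrough_comm p q
  unfold pathDist
  grind

theorem pathDist_self (p : Rep G hG) : pathDist p p = 0 := by
  have h := distThrough_nonneg p p
  simp [pathDist, h]

theorem distVertex_le (p : Rep G hG) (a b : V) :
    p.distVertex b ≤ p.distVertex a + G.dist a b := by
  have h1 := dist_tri hG p.fst a b
  have h2 := dist_tri hG p.snd a b
  unfold distVertex
  grind

theorem dist_le_distVertex (p : Rep G hG) (a b : V) :
    (G.dist a b : ℝ) ≤ p.distVertex a + p.distVertex b := by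
  have h1 := dist_tri hG a p.fst b
  have h2 := dist_tri hG a p.snd b
  have h3 := dist_tri hG p.fst p.snd b
  have h4 := dist_tri hG p.snd p.fst b
  have h5 := p.dist_ends_le
  have h6 := p.pos_nonneg
  have h7 := p.pos_le_one
  rw [G.dist_comm (u := a) (v := p.fst)] at h1
  rw [G.dist_comm (u := a) (v := p.snd)] at h2
  rw [G.dist_comm (u := p.snd) (v := p.fst)] at h4
  unfold distVertex
  grind

theorem distThrough_le (p q : Rep G hG) (w : V) :
    distThrough p q ≤ p.distVertex w + q.distVertex w := by
  have h1 := p.distVertex_le w q.fst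
  have h2 := p.distVertex_le w q.snd
  rw [G.dist_comm (u := w)] at h1 h2
  have h3 : q.distVertex w = min (q.pos + G.dist q.fst w) ((1 - q.pos) + G.dist q.snd w) := rfl
  unfold distThrough
  grind

theorem exists_distThrough (p q : Rep G hG) :
    ∃ w, p.distVertex w + q.distVertex w ≤ distThrough p q := by
  have h1 : q.distVertex q.fst ≤ q.pos := (min_le_left _ _).trans (by simp)
  have h2 : q.distVertex q.snd ≤ 1 - q.pos := (min_le_right _ _).trans (by simp)
  rcases min_choice (p.distVertex q.fst + q.pos) (p.distVertex q.snd + (1 - q.pos)) with h | h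
  · exact ⟨q.fst, by unfold distThrough; rw [h]; linarith⟩
  · exact ⟨q.snd, by unfold distThrough; rw [h]; linarith⟩

theorem pathDist_le_distThrough (p q : Rep G hG) : pathDist p q ≤ distThrough p q := by
  unfold pathDist
  grind

theorem distVertex_le_pathDist (p q : Rep G hG) (w : V) :
    p.distVertex w ≤ pathDist p q + q.distVertex w := by
  have hT : p.distVertex w ≤ distThrough p q + q.distVertex w := by
    obtain ⟨a, ha⟩ := exists_distThrough p q
    have h1 := p.distVertex_le a w
    have h2 := q.dist_le_distVertex a w
    linarith
  unfold pathDist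
  unfold distVertex at *
  have := abs_le.mp (le_refl |p.pos - q.pos|)
  have := abs_le.mp (le_refl |p.pos - (1 - q.pos)|)
  grind

theorem pathDist_triangle (p q r : Rep G hG) : pathDist p r ≤ pathDist p q + pathDist q r := by
  by_cases h1 : pathDist p q = distThrough p q
  · obtain ⟨w, hw⟩ := exists_distThrough p q
    have h2 := distVertex_le_pathDist r q w
    rw [pathDist_comm r q] at h2
    have h3 := distThrough_le p r w
    have h4 := pathDist_le_distThrough p r
    linarith
  by_cases h2 : pathDist q r = distThrough q r
  · obtain ⟨w, hw⟩ := exists_distThrough q r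
    have h2 := distVertex_le_pathDist p q w
    have h3 := distThrough_le p r w
    have h4 := pathDist_le_distThrough p r
    linarith
  have e1 := abs_sub_le p.pos q.pos r.pos
  have e2 := abs_sub_le p.pos q.pos (1 - r.pos)
  have e3 := abs_sub_le p.pos (1 - q.pos) r.pos
  have e4 := abs_sub_le p.pos (1 - q.pos) (1 - r.pos)
  have e5 : |1 - q.pos - r.pos| = |q.pos - (1 - r.pos)| := by rw [abs_sub_comm]; ring_nf
  have e6 : |1 - q.pos - (1 - r.pos)| = |q.pos - r.pos| := by rw [abs_sub_comm]; ring_nf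
  unfold pathDist at *
  grind

noncomputable instance : PseudoMetricSpace (Rep G hG) where
  dist := pathDist
  dist_self := pathDist_self
  dist_comm := pathDist_comm
  dist_triangle := pathDist_triangle

end Rep

end MetricGraph

/-- The metric graph of the connected graph `G`: each edge is a copy of `[0, 1]`, the distance is
the length of a shortest path, and representatives at distance zero are identified. Its metric
structure is the one that Mathlib puts on the separation quotient. -/
abbrev MetricGraph {V : Type*} (G : SimpleGraph V) (hG : G.Connected) : Type _ :=
  SeparationQuotient (MetricGraph.Rep G hG)

/-! ### Cycles -/

/-- The graph has proper cycles: each edge belongs to at most one cycle, where a cycle is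
regarded as a subgraph. -/
def SimpleGraph.HasProperCycles {V : Type*} (G : SimpleGraph V) : Prop :=
  ∀ (e : Sym2 V) (u v : V) (c : G.Walk u u) (c' : G.Walk v v), c.IsCycle → c'.IsCycle →
    e ∈ c.edges → e ∈ c'.edges → c.toSubgraph = c'.toSubgraph

/-- The circumference of the graph: the supremum of the lengths of its cycles
(zero if there are none, `∞` if the lengths are unbounded). -/
noncomputable def SimpleGraph.circumference {V : Type*} (G : SimpleGraph V) : ℝ≥0∞ :=
  ⨆ (v : V) (c : G.Walk v v) (_ : c.IsCycle), (c.length : ℝ≥0∞)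

namespace SimpleGraph

variable {V : Type*} {G : SimpleGraph V}

/-- A gate map onto the set of edges `K`: a retraction of the vertices onto the ends of the edges
of `K` that is constant along the edges outside `K`. -/
structure GateMap (G : SimpleGraph V) (K : Set (Sym2 V)) where
  gate : V → V
  subset : K ⊆ G.edgeSet
  gate_mem : ∀ v, ∃ e ∈ K, gate v ∈ e
  gate_eq_self : ∀ v, ∀ e ∈ K, v ∈ e → gate v = v
  gate_eq_gate : ∀ u v, G.Adj u v → s(u, v) ∉ K → gate u = gate v

theorem exists_reachable_deleteEdges (hG : G.Connected) {K : Set (Sym2 V)} {e : Sym2 V}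
    (he : e ∈ K) (v : V) :
    ∃ w, (∃ e ∈ K, w ∈ e) ∧ (G.deleteEdges K).Reachable v w := by
  obtain ⟨a, b⟩ := e
  obtain ⟨p⟩ := hG v a
  induction p with
  | nil => exact ⟨_, ⟨_, he, Sym2.mem_mk_left _ _⟩, Reachable.refl _⟩
  | @cons u v w h p ih =>
    by_cases hK : s(u, v) ∈ K
    · exact ⟨u, ⟨_, hK, Sym2.mem_mk_left _ _⟩, Reachable.refl _⟩
    · obtain ⟨x, hx, hr⟩ := ih he
      have hadj : (G.deleteEdges K).Adj u v := by simp [h, hK]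
      exact ⟨x, hx, hadj.reachable.trans hr⟩

theorem nonempty_gateMap (hG : G.Connected) {K : Set (Sym2 V)} (hK : K ⊆ G.edgeSet)
    {e : Sym2 V} (he : e ∈ K)
    (hsep : ∀ a b, (∃ e ∈ K, a ∈ e) → (∃ e ∈ K, b ∈ e) → (G.deleteEdges K).Reachable a b → a = b) :
    Nonempty (GateMap G K) := by
  choose f hf hr using exists_reachable_deleteEdges hG he
  refine ⟨⟨f, hK, hf, fun v e he hv => ?_, fun u v h huv => ?_⟩⟩
  · exact hsep _ _ (hf v) ⟨e, he, hv⟩ (hr v).symm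
  · have hadj : (G.deleteEdges K).Adj u v := by simp [h, huv]
    exact hsep _ _ (hf u) (hf v) ((hr u).symm.trans (hadj.reachable.trans (hr v)))

theorem GateMap.gate_eq_or_dist_le (hG : G.Connected) {K : Set (Sym2 V)} (F : GateMap G K)
    (v w : V) :
    F.gate v = F.gate w ∨ G.dist v (F.gate v) + G.dist (F.gate v) w ≤ G.dist v w := by
  obtain ⟨p, hp⟩ := hG.exists_walk_length_eq_dist v w
  rw [← hp]
  clear hp
  induction p with
  | nil => exact Or.inl rfl
  | @cons u v w h p ih =>
    by_cases hK : s(u, v) ∈ K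
    · right
      rw [F.gate_eq_self u _ hK (Sym2.mem_mk_left _ _)]
      simpa using dist_le (Walk.cons h p)
    · rw [F.gate_eq_gate u v h hK]
      refine ih.imp_right fun ih => ?_
      have h1 : G.dist u (F.gate v) ≤ G.dist u v + G.dist v (F.gate v) := hG.dist_triangle
      rw [dist_eq_one_iff_adj.mpr h] at h1
      rw [Walk.length_cons]
      lia

/-- A bridge has a gate map. -/
theorem nonempty_gateMap_singleton (hG : G.Connected) {u v : V} (h : G.Adj u v)
    (hc : ∀ (w : V) (c : G.Walk w w), c.IsCycle → s(u, v) ∉ c.edges) :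
    Nonempty (GateMap G {s(u, v)}) := by
  have hb : ¬ (G.deleteEdges {s(u, v)}).Reachable u v :=
    isBridge_iff.mp ((isBridge_iff_forall_cycle_notMem (G.mem_edgeSet.mpr h)).mpr
      fun w c hc' => hc w c hc')
  refine nonempty_gateMap hG (by simpa using h) rfl ?_
  simp only [Set.mem_singleton_iff, exists_eq_left, Sym2.mem_iff]
  rintro a b (rfl | rfl) (rfl | rfl) hr
  · rfl
  · exact absurd hr hb
  · exact absurd hr.symm hb
  · rfl

theorem Walk.IsTrail.reachable_snd {a b : V} {p : G.Walk a b} (hp : p.IsTrail) (hab : a ≠ b)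
    {f : Sym2 V} (hf : f ∉ p.edges) :
    G.Adj a p.snd ∧ s(a, p.snd) ∈ p.edges ∧
      ((G.deleteEdges {f}).deleteEdges {s(a, p.snd)}).Reachable b p.snd := by
  cases p with
  | nil => exact absurd rfl hab
  | @cons _ x _ h q =>
    rw [isTrail_cons] at hp
    simp only [edges_cons, List.mem_cons, not_or] at hf
    rw [snd_cons]
    refine ⟨h, by simp, ?_⟩
    rw [deleteEdges_deleteEdges]
    refine (Walk.toDeleteEdges _ q fun e he => ?_).reachable.symm
    simp only [Set.union_singleton, Set.mem_insert_iff, Set.mem_singleton_iff, not_or]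
    exact ⟨fun h => hp.2 (h ▸ he), fun h => hf.2 (h ▸ he)⟩

theorem HasProperCycles.eq_of_reachable (hproper : G.HasProperCycles) {v : V} {c : G.Walk v v}
    (hc : c.IsCycle) {a b : V} (ha : a ∈ c.support) (hb : b ∈ c.support)
    (hr : (G.deleteEdges {e | e ∈ c.edges}).Reachable a b) : a = b := by
  classical
  by_contra hab
  have hb' : b ∈ (c.rotate a ha).support := (c.mem_support_rotate_iff a ha).mpr hb
  have hd : (c.rotate a ha).IsCycle := (Walk.isCycle_rotate ha).mpr hc
  have hmem : ∀ e, e ∈ (c.rotate a ha).edges ↔ e ∈ c.edges :=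
    fun e => (c.rotate_edges a ha).mem_iff
  generalize c.rotate a ha = d at hb' hd hmem
  have hdisj := hd.isTrail.disjoint_edges_takeUntil_dropUntil hb'
  have htake := hd.isTrail.takeUntil hb'
  have hdrop := hd.isTrail.dropUntil hb'
  have hsub1 := d.edges_takeUntil_subset_edges hb'
  have hsub2 := d.edges_dropUntil_subset_edges hb'
  set p := d.takeUntil b hb'
  set q := d.dropUntil b hb'
  have hq : s(b, q.snd) ∈ q.edges :=
    (hdrop.reachable_snd (Ne.symm hab) (f := s(b, b)) fun h =>
      (q.adj_of_mem_edges h).ne rfl).2.1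
  set f := s(b, q.snd)
  obtain ⟨hadj, hmem_e, hreach⟩ := htake.reachable_snd hab (f := f) fun h => hdisj h hq
  have hfe : s(a, p.snd) ≠ f := fun h => hdisj hmem_e (h ▸ hq)
  have hr' : ((G.deleteEdges {f}).deleteEdges {s(a, p.snd)}).Reachable a b := by
    refine hr.mono ?_
    rw [deleteEdges_deleteEdges]
    refine deleteEdges_anti ?_
    rintro e (rfl | rfl)
    · exact (hmem _).mp (hsub2 hq)
    · exact (hmem _).mp (hsub1 hmem_e)
  obtain ⟨w, z, hz, hez⟩ := adj_and_reachable_delete_edges_iff_exists_cycle.mp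
    ⟨(deleteEdges_adj.mpr ⟨hadj, hfe⟩ : (G.deleteEdges {f}).Adj a p.snd), hr'.trans hreach⟩
  have hle : G.deleteEdges {f} ≤ G := deleteEdges_le _
  have heq := hproper s(a, p.snd) _ _ (z.mapLe hle) d ((Walk.isCycle_mapLe hle).mpr hz) hd
    (by rwa [Walk.edges_mapLe_eq_edges]) (hsub1 hmem_e)
  have hfz : f ∈ (z.mapLe hle).edges := by
    rw [← Walk.mem_edges_toSubgraph, heq, Walk.mem_edges_toSubgraph]
    exact hsub2 hq
  rw [Walk.edges_mapLe_eq_edges] at hfz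
  have := z.edges_subset_edgeSet hfz
  simp at this

/-- A cycle of a graph with proper cycles has a gate map. -/
theorem HasProperCycles.nonempty_gateMap (hG : G.Connected) (hproper : G.HasProperCycles) {v : V}
    {c : G.Walk v v} (hc : c.IsCycle) : Nonempty (GateMap G {e | e ∈ c.edges}) := by
  obtain ⟨e, he⟩ := List.exists_mem_of_ne_nil c.edges (by
    have := hc.three_le_length
    rw [← Walk.length_edges] at this
    intro h
    simp [h] at this)
  refine SimpleGraph.nonempty_gateMap hG (fun e he => c.edges_subset_edgeSet he)
    (e := e) he ?_
  have aux : ∀ a : V, (∃ e ∈ {e | e ∈ c.edges}, a ∈ e) → a ∈ c.support := by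
    rintro a ⟨e, he, ha⟩
    exact Walk.mem_support_of_mem_edges he ha
  exact fun a b ha hb hr => hproper.eq_of_reachable hc (aux a ha) (aux b hb) hr

/-- The vertices of a closed walk, periodically indexed by the integers. -/
def Walk.cyc {v : V} (c : G.Walk v v) (n : ℤ) : V := c.getVert (n % c.length).toNat

namespace Walk

variable {v : V} {c : G.Walk v v}

theorem cyc_add_mul (n k : ℤ) : c.cyc (n + k * c.length) = c.cyc n := by
  simp [cyc]

theorem cyc_of_le {i : ℕ} (hi : i ≤ c.length) : c.cyc i = c.getVert i := by
  rcases hi.lt_or_eq with hi | rfl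
  · rw [cyc, Int.emod_eq_of_lt (by lia) (by lia), Int.toNat_natCast]
  · simp [cyc]

theorem IsCycle.exists_eq_add_mul (hc : c.IsCycle) (n : ℤ) :
    ∃ i < c.length, ∃ k : ℤ, n = i + k * c.length := by
  have hL := hc.three_le_length
  have h1 := Int.emod_nonneg n (b := c.length) (by lia)
  have h2 := Int.emod_lt_of_pos n (b := c.length) (by lia)
  refine ⟨(n % c.length).toNat, by lia, n / c.length, ?_⟩
  rw [Int.toNat_of_nonneg h1]
  exact (Int.emod_add_ediv_mul n _).symm

theorem IsCycle.mk_cyc_mem_edges (hc : c.IsCycle) (n : ℤ) :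
    s(c.cyc n, c.cyc (n + 1)) ∈ c.edges := by
  obtain ⟨i, hi, k, rfl⟩ := hc.exists_eq_add_mul n
  rw [show (i + k * c.length + 1 : ℤ) = ((i + 1 : ℕ) : ℤ) + k * c.length by push_cast; ring,
    cyc_add_mul, cyc_add_mul, cyc_of_le hi.le, cyc_of_le hi]
  exact (c.mk_mem_edges_iff_exists).mpr ⟨i, hi, rfl⟩

theorem IsCycle.adj_cyc (hc : c.IsCycle) (n : ℤ) : G.Adj (c.cyc n) (c.cyc (n + 1)) :=
  c.adj_of_mem_edges (hc.mk_cyc_mem_edges n)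

theorem exists_cyc_of_mem_edges {x y : V} (h : s(x, y) ∈ c.edges) :
    ∃ n : ℤ, (x = c.cyc n ∧ y = c.cyc (n + 1)) ∨ (x = c.cyc (n + 1) ∧ y = c.cyc n) := by
  obtain ⟨i, hi, h⟩ := (c.mk_mem_edges_iff_exists).mp h
  rw [← cyc_of_le hi.le, ← cyc_of_le (i := i + 1) hi] at h
  refine ⟨i, ?_⟩
  have := Sym2.eq_iff.mp h
  push_cast at this
  grind

theorem IsCycle.exists_eq_of_cyc_eq (hc : c.IsCycle) {m n : ℤ} (h : c.cyc m = c.cyc n) :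
    ∃ k : ℤ, m = n + k * c.length := by
  obtain ⟨i, hi, k, rfl⟩ := hc.exists_eq_add_mul m
  obtain ⟨j, hj, l, rfl⟩ := hc.exists_eq_add_mul n
  rw [cyc_add_mul, cyc_add_mul, cyc_of_le hi.le, cyc_of_le hj.le] at h
  have hij : i = j := hc.getVert_injOn' (by simp only [Set.mem_ofPred_eq]; lia)
    (by simp only [Set.mem_ofPred_eq]; lia) h
  exact ⟨k - l, by rw [hij]; ring⟩

theorem IsCycle.dist_cyc_le (hc : c.IsCycle) (hG : G.Connected) (m : ℤ) (n : ℕ) :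
    G.dist (c.cyc m) (c.cyc (m + n)) ≤ n := by
  induction n with
  | zero => simp
  | succ n ih =>
    have h1 : G.dist (c.cyc m) (c.cyc (m + n + 1)) ≤
      G.dist (c.cyc m) (c.cyc (m + n)) + G.dist (c.cyc (m + n)) (c.cyc (m + n + 1)) :=
      hG.dist_triangle
    rw [dist_eq_one_iff_adj.mpr (hc.adj_cyc (m + n))] at h1
    push_cast
    rw [← add_assoc]
    lia

theorem IsCycle.exists_le_dist_cyc (hc : c.IsCycle) (hG : G.Connected)
    (F : GateMap G {e | e ∈ c.edges}) (m n : ℤ) :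
    ∃ k : ℤ, |m - n + k * c.length| ≤ G.dist (c.cyc m) (c.cyc n) := by
  have key : ∀ x (p : G.Walk x (c.cyc n)), ∃ l : ℤ, F.gate x = c.cyc l ∧ |l - n| ≤ p.length := by
    intro x p
    generalize hy : c.cyc n = y at p
    induction p with
    | nil =>
      refine ⟨n, ?_, by simp⟩
      rw [hy, ← hy]
      exact F.gate_eq_self _ _ (hc.mk_cyc_mem_edges n) (Sym2.mem_mk_left _ _)
    | @cons u v w h p ih =>
      obtain ⟨l, hl, hle⟩ := ih hy
      rw [length_cons]
      by_cases hK : s(u, v) ∈ c.edges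
      · rw [F.gate_eq_self v _ hK (Sym2.mem_mk_right _ _)] at hl
        rw [F.gate_eq_self u _ hK (Sym2.mem_mk_left _ _)]
        obtain ⟨a, ⟨hu, hv⟩ | ⟨hu, hv⟩⟩ := exists_cyc_of_mem_edges hK
        · obtain ⟨k, hk⟩ := hc.exists_eq_of_cyc_eq (hl.symm.trans hv)
          refine ⟨l - 1, ?_, by push_cast; grind⟩
          rw [hk, hu, show a + 1 + k * c.length - 1 = a + k * c.length by ring, cyc_add_mul]
        · obtain ⟨k, hk⟩ := hc.exists_eq_of_cyc_eq (hl.symm.trans hv)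
          refine ⟨l + 1, ?_, by push_cast; grind⟩
          rw [hk, hu, show a + k * c.length + 1 = a + 1 + k * c.length by ring, cyc_add_mul]
      · rw [F.gate_eq_gate u v h hK]
        exact ⟨l, hl, by push_cast; lia⟩
  obtain ⟨p, hp⟩ := hG.exists_walk_length_eq_dist (c.cyc m) (c.cyc n)
  obtain ⟨l, hl, hle⟩ := key _ p
  rw [F.gate_eq_self _ _ (hc.mk_cyc_mem_edges m) (Sym2.mem_mk_left _ _)] at hl
  obtain ⟨k, hk⟩ := hc.exists_eq_of_cyc_eq hl
  refine ⟨-k, ?_⟩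
  rw [← hp, show m - n + -k * c.length = l - n by rw [hk]; ring]
  exact hle

end Walk

end SimpleGraph

namespace MetricGraph

variable {V : Type*} {G : SimpleGraph V} {hG : G.Connected} {K : Set (Sym2 V)}

namespace Rep

/-- The vertex `v` as a point of the metric graph. -/
def vtx (hG : G.Connected) (v : V) : Rep G hG := ⟨v, v, 0, Or.inr ⟨rfl, rfl⟩⟩

theorem dist_def (p q : Rep G hG) : dist p q = pathDist p q := rfl

theorem dist_vtx (p : Rep G hG) (w : V) : dist p (vtx hG w) = p.distVertex w := by
  have h0 := p.pos_nonneg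
  have h1 := p.valid
  have h2 : G.dist w w = 0 := G.dist_self
  have h3 : p.fst = p.snd → p.pos = 0 := fun h => by
    rcases h1 with h1 | h1
    · exact absurd h h1.1.ne
    · exact h1.2
  simp only [dist_def, pathDist, distThrough, vtx]
  by_cases h : p.fst = w ∧ p.snd = w
  · have h4 := h3 (h.1.trans h.2.symm)
    simp [distVertex, h.1, h.2, h4]
  · simp [h]

theorem dist_vtx_vtx (v w : V) : dist (vtx hG v) (vtx hG w) = G.dist v w := by
  rw [dist_vtx]
  simp [distVertex, vtx]

theorem dist_vtx_fst_le (p : Rep G hG) : dist p (vtx hG p.fst) ≤ p.pos := by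
  rw [dist_vtx]
  simp [distVertex]

theorem dist_vtx_snd_le (p : Rep G hG) : dist p (vtx hG p.snd) ≤ 1 - p.pos := by
  rw [dist_vtx]
  simp [distVertex]

theorem dist_eq_of_edge {u v : V} {s t : ℝ} (h : G.Adj u v)
    (hs : (G.Adj u v ∧ 0 ≤ s ∧ s ≤ 1) ∨ (u = v ∧ s = 0))
    (ht : (G.Adj u v ∧ 0 ≤ t ∧ t ≤ 1) ∨ (u = v ∧ t = 0)) :
    dist (⟨u, v, s, hs⟩ : Rep G hG) ⟨u, v, t, ht⟩ = |s - t| := by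
  have h1 : G.dist u v = 1 := SimpleGraph.dist_eq_one_iff_adj.mpr h
  have h2 : G.dist v u = 1 := SimpleGraph.dist_eq_one_iff_adj.mpr h.symm
  have h3 := h.ne
  simp only [dist_def, pathDist, distThrough, distVertex, h1, h2, SimpleGraph.dist_self]
  push_cast
  grind

/-- Two points lie on the same edge, or a shortest path joining them passes through ends of their
edges. -/
theorem edge_eq_or_exists_dist_le (p q : Rep G hG) :
    s(p.fst, p.snd) = s(q.fst, q.snd) ∨
      ∃ a b, (a = p.fst ∨ a = p.snd) ∧ (b = q.fst ∨ b = q.snd) ∧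
        dist p (vtx hG a) + G.dist a b + dist (vtx hG b) q ≤ dist p q := by
  by_cases he : s(p.fst, p.snd) = s(q.fst, q.snd)
  · exact Or.inl he
  right
  have hd : dist p q = distThrough p q := by
    rw [Sym2.eq_iff] at he
    rw [dist_def, pathDist]
    grind
  have h1 := p.dist_vtx_fst_le
  have h2 := p.dist_vtx_snd_le
  have h3 := q.dist_vtx_fst_le
  have h4 := q.dist_vtx_snd_le
  rw [dist_comm] at h3 h4
  have hT : distThrough p q = p.pos + G.dist p.fst q.fst + q.pos ∨
      distThrough p q = p.pos + G.dist p.fst q.snd + (1 - q.pos) ∨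
      distThrough p q = (1 - p.pos) + G.dist p.snd q.fst + q.pos ∨
      distThrough p q = (1 - p.pos) + G.dist p.snd q.snd + (1 - q.pos) := by
    unfold distThrough distVertex
    grind
  rcases hT with h | h | h | h
  · exact ⟨p.fst, q.fst, Or.inl rfl, Or.inl rfl, by linarith⟩
  · exact ⟨p.fst, q.snd, Or.inl rfl, Or.inr rfl, by linarith⟩
  · exact ⟨p.snd, q.fst, Or.inr rfl, Or.inl rfl, by linarith⟩
  · exact ⟨p.snd, q.snd, Or.inr rfl, Or.inr rfl, by linarith⟩

open Classical in
/-- The retraction of the metric graph onto the edges of `K`. -/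
noncomputable def retract (F : G.GateMap K) (p : Rep G hG) : Rep G hG :=
  if s(p.fst, p.snd) ∈ K then p else vtx hG (F.gate p.fst)

theorem retract_of_mem (F : G.GateMap K) {p : Rep G hG} (h : s(p.fst, p.snd) ∈ K) :
    retract F p = p := if_pos h

theorem retract_of_notMem (F : G.GateMap K) {p : Rep G hG} (h : s(p.fst, p.snd) ∉ K) :
    retract F p = vtx hG (F.gate p.fst) := if_neg h

theorem gate_snd (F : G.GateMap K) {p : Rep G hG} (h : s(p.fst, p.snd) ∉ K) :
    F.gate p.snd = F.gate p.fst := by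
  rcases p.valid with h1 | h1
  · exact (F.gate_eq_gate _ _ h1.1 h).symm
  · rw [h1.1]

theorem retract_eq_or_dist_le (F : G.GateMap K) (p q : Rep G hG) :
    retract F p = retract F q ∨
      dist p (retract F p) + dist (retract F p) q ≤ dist p q := by
  by_cases hp : s(p.fst, p.snd) ∈ K
  · right
    simp [retract_of_mem F hp]
  rw [retract_of_notMem F hp]
  rcases edge_eq_or_exists_dist_le p q with he | ⟨a, b, ha, hb, hab⟩
  · left
    rw [retract_of_notMem F (he ▸ hp)]
    rcases Sym2.eq_iff.mp he with h | h
    · rw [h.1]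
    · rw [← h.2, gate_snd F hp]
  have ha' : F.gate a = F.gate p.fst := by
    rcases ha with rfl | rfl
    · rfl
    · exact gate_snd F hp
  have h1 := dist_triangle p (vtx hG a) (vtx hG (F.gate p.fst))
  have h2 := dist_triangle (vtx hG (F.gate p.fst)) (vtx hG b) q
  rw [dist_vtx_vtx] at h1 h2
  rcases F.gate_eq_or_dist_le hG a b with h | h
  · by_cases hq : s(q.fst, q.snd) ∈ K
    · right
      have hb' : F.gate b = b := by
        refine F.gate_eq_self b _ hq ?_
        rcases hb with rfl | rfl
        · exact Sym2.mem_mk_left _ _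
        · exact Sym2.mem_mk_right _ _
      rw [← ha', h, hb'] at h1 h2 ⊢
      rw [SimpleGraph.dist_self] at h2
      push_cast at h2
      linarith
    · left
      rw [retract_of_notMem F hq]
      have hb' : F.gate b = F.gate q.fst := by
        rcases hb with rfl | rfl
        · rfl
        · exact gate_snd F hq
      rw [← ha', h, hb']
  · right
    rw [ha'] at h
    have h3 : (G.dist a (F.gate p.fst) : ℝ) + G.dist (F.gate p.fst) b ≤ G.dist a b := by
      exact_mod_cast h
    linarith

end Rep

open MetricGraph.Rep

theorem mk_eq_mk_of_dist {p q : Rep G hG} (h : dist p q = 0) :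
    SeparationQuotient.mk p = SeparationQuotient.mk q :=
  SeparationQuotient.mk_eq_mk.mpr (Metric.inseparable_iff.mpr h)

/-- The vertex `v` as a point of the quotient. -/
noncomputable def vertex (hG : G.Connected) (v : V) : MetricGraph G hG := SeparationQuotient.mk (vtx hG v)

theorem dist_vertex (v w : V) : dist (vertex hG v) (vertex hG w) = G.dist v w := by
  rw [vertex, vertex, SeparationQuotient.dist_mk, dist_vtx_vtx]

/-- The retraction of the metric graph onto the edges of `K`. -/
noncomputable def proj (F : G.GateMap K) (x : MetricGraph G hG) : MetricGraph G hG :=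
  SeparationQuotient.mk (retract F (Function.surjInv SeparationQuotient.surjective_mk x))

theorem proj_mk (F : G.GateMap K) (p : Rep G hG) :
    proj F (SeparationQuotient.mk p) = SeparationQuotient.mk (retract F p) := by
  have hq : SeparationQuotient.mk (Function.surjInv SeparationQuotient.surjective_mk
    (SeparationQuotient.mk p)) = SeparationQuotient.mk p :=
    Function.surjInv_eq SeparationQuotient.surjective_mk _
  unfold proj
  generalize Function.surjInv SeparationQuotient.surjective_mk (SeparationQuotient.mk p) = q at *
  have h0 : dist q p = 0 := by rw [← SeparationQuotient.dist_mk, hq, dist_self]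
  have h0' : dist p q = 0 := by rw [dist_comm, h0]
  rcases retract_eq_or_dist_le F p q with h | h
  · rw [h]
  rcases retract_eq_or_dist_le F q p with h' | h'
  · rw [h']
  have e1 : dist p (retract F p) = 0 := by
    linarith [dist_nonneg (x := p) (y := retract F p), dist_nonneg (x := retract F p) (y := q)]
  have e2 : dist q (retract F q) = 0 := by
    linarith [dist_nonneg (x := q) (y := retract F q), dist_nonneg (x := retract F q) (y := p)]
  rw [← mk_eq_mk_of_dist e1, ← mk_eq_mk_of_dist e2, hq]

theorem proj_eq_or_dist_le (F : G.GateMap K) (x y : MetricGraph G hG) :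
    proj F x = proj F y ∨ dist x (proj F x) + dist (proj F x) y ≤ dist x y := by
  obtain ⟨p, rfl⟩ := SeparationQuotient.surjective_mk x
  obtain ⟨q, rfl⟩ := SeparationQuotient.surjective_mk y
  simp only [proj_mk, SeparationQuotient.dist_mk]
  exact (retract_eq_or_dist_le F p q).imp_left fun h => by rw [h]

theorem exists_proj_eq (F : G.GateMap K) (x : MetricGraph G hG) :
    ∃ p : Rep G hG, s(p.fst, p.snd) ∈ K ∧ proj F x = SeparationQuotient.mk p := by
  obtain ⟨p, rfl⟩ := SeparationQuotient.surjective_mk x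
  rw [proj_mk]
  by_cases h : s(p.fst, p.snd) ∈ K
  · exact ⟨p, h, by rw [retract_of_mem F h]⟩
  · rw [retract_of_notMem F h]
    obtain ⟨e, he, hmem⟩ := F.gate_mem p.fst
    obtain ⟨w, rfl⟩ := hmem
    have hadj : G.Adj (F.gate p.fst) w := F.subset he
    refine ⟨⟨F.gate p.fst, w, 0, Or.inl ⟨hadj, le_rfl, zero_le_one⟩⟩, he, mk_eq_mk_of_dist ?_⟩
    rw [dist_comm]
    exact le_antisymm (dist_vtx_fst_le _) dist_nonneg

theorem proj_proj (F : G.GateMap K) (x : MetricGraph G hG) : proj F (proj F x) = proj F x := by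
  obtain ⟨p, hp, h⟩ := exists_proj_eq F x
  rw [h, proj_mk, retract_of_mem F hp]

theorem proj_eq_self_of_forall_ne (F : G.GateMap K) {x : MetricGraph G hG}
    (h : ∀ v, proj F x ≠ vertex hG v) : proj F x = x := by
  obtain ⟨p, rfl⟩ := SeparationQuotient.surjective_mk x
  rw [proj_mk] at h ⊢
  by_cases hp : s(p.fst, p.snd) ∈ K
  · rw [retract_of_mem F hp]
  · rw [retract_of_notMem F hp] at h
    exact absurd rfl (h _)

theorem dist_proj_le (F : G.GateMap K) (x y : MetricGraph G hG) :
    dist (proj F x) (proj F y) ≤ dist x y := by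
  rcases proj_eq_or_dist_le F x y with h | h
  · rw [h, dist_self]
    exact dist_nonneg
  have h1 : dist (proj F x) y ≤ dist x y := by linarith [dist_nonneg (x := x) (y := proj F x)]
  refine le_trans ?_ h1
  rcases proj_eq_or_dist_le F y (proj F x) with h' | h'
  · rw [h', proj_proj, dist_self]
    exact dist_nonneg
  · rw [dist_comm, dist_comm _ y]
    linarith [dist_nonneg (x := y) (y := proj F y)]

theorem continuous_proj (F : G.GateMap K) : Continuous (proj F : MetricGraph G hG → _) :=
  (LipschitzWith.of_dist_le_mul (K := 1) fun x y => by
    simpa using dist_proj_le F x y).continuous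

theorem eventually_proj_eq (F : G.GateMap K) {x : MetricGraph G hG} (hx : proj F x ≠ x) :
    ∀ᶠ y in nhds x, proj F y = proj F x := by
  filter_upwards [Metric.ball_mem_nhds x (dist_pos.mpr (Ne.symm hx))] with y hy
  rw [Metric.mem_ball, dist_comm] at hy
  rcases proj_eq_or_dist_le F x y with h | h
  · exact h.symm
  · linarith [dist_nonneg (x := proj F x) (y := y)]

/-- A connected set that avoids the projection of one of its points projects to one point. -/
theorem proj_eq_of_proj_notMem (F : G.GateMap K) {T : Set (MetricGraph G hG)}
    (hT : IsPreconnected T) {x y : MetricGraph G hG} (hx : x ∈ T) (hy : y ∈ T)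
    (h : proj F x ∉ T) : proj F y = proj F x := by
  by_contra hne
  have hmem : ∀ z ∈ T, proj F z = proj F x → z ∈ interior {z | proj F z = proj F x} := by
    intro z hz hzx
    rw [mem_interior_iff_mem_nhds]
    have := eventually_proj_eq F (x := z) fun hzz => h (by rwa [← hzx, hzz])
    rwa [hzx] at this
  obtain ⟨z, -, hz1, hz2⟩ := hT (interior {z | proj F z = proj F x}) {z | proj F z ≠ proj F x}
    isOpen_interior (isOpen_ne.preimage (continuous_proj F))
    (fun z hz => (em _).imp (hmem z hz) id) ⟨x, hx, hmem x hx rfl⟩ ⟨y, hy, hne⟩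
  have hz3 : z ∈ {z | proj F z = proj F x} := interior_subset hz1
  exact hz2 hz3

end MetricGraph

namespace MetricGraph

variable {V : Type*} {G : SimpleGraph V} {hG : G.Connected}

open MetricGraph.Rep

variable {v : V} {c : G.Walk v v}

/-- The parametrization of a cycle by arc length, as representatives. -/
noncomputable def cycleRep (hG : G.Connected) (hc : c.IsCycle) (s : ℝ) : Rep G hG :=
  ⟨c.cyc ⌊s⌋, c.cyc (⌊s⌋ + 1), Int.fract s,
    Or.inl ⟨hc.adj_cyc _, Int.fract_nonneg s, (Int.fract_lt_one s).le⟩⟩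

theorem cycleRep_add_mul (hc : c.IsCycle) (s : ℝ) (k : ℤ) :
    cycleRep hG hc (s + k * c.length) = cycleRep hG hc s := by
  have h1 : (s + k * c.length : ℝ) = s + ((k * c.length : ℤ) : ℝ) := by push_cast; ring
  have h2 : ⌊(s + k * c.length : ℝ)⌋ = ⌊s⌋ + k * c.length := by rw [h1, Int.floor_add_intCast]
  have h3 : Int.fract (s + k * c.length : ℝ) = Int.fract s := by rw [h1, Int.fract_add_intCast]
  simp only [cycleRep, Rep.mk.injEq]
  rw [h2, h3, add_right_comm, SimpleGraph.Walk.cyc_add_mul, SimpleGraph.Walk.cyc_add_mul]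
  simp

theorem dist_cycleRep_le (hc : c.IsCycle) (s t : ℝ) :
    dist (cycleRep hG hc s) (cycleRep hG hc t) ≤ |s - t| := by
  wlog hst : s ≤ t generalizing s t
  · rw [dist_comm, abs_sub_comm]
    exact this t s (le_of_not_ge hst)
  have hs := Int.floor_add_fract s
  have ht := Int.floor_add_fract t
  have hs1 := Int.fract_lt_one s
  rw [abs_sub_comm, abs_of_nonneg (sub_nonneg.mpr hst)]
  rcases (Int.floor_le_floor hst).eq_or_lt with h | h
  · have h1 : pathDist (cycleRep hG hc s) (cycleRep hG hc t) ≤ |Int.fract s - Int.fract t| := by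
      simp [pathDist, cycleRep, h]
    refine h1.trans ?_
    rw [h] at hs
    rw [abs_le]
    constructor <;> linarith
  · obtain ⟨n, hn⟩ := Int.le.dest (Int.add_one_le_of_lt h)
    have h1 : dist (cycleRep hG hc s) (vtx hG (c.cyc (⌊s⌋ + 1))) ≤ 1 - Int.fract s :=
      dist_vtx_snd_le _
    have h2 : dist (cycleRep hG hc t) (vtx hG (c.cyc ⌊t⌋)) ≤ Int.fract t := dist_vtx_fst_le _
    have h3 := hc.dist_cyc_le hG (⌊s⌋ + 1) n
    rw [hn] at h3
    have h4 : (G.dist (c.cyc (⌊s⌋ + 1)) (c.cyc ⌊t⌋) : ℝ) ≤ n := by exact_mod_cast h3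
    have h5 : (⌊s⌋ : ℝ) + 1 + n = ⌊t⌋ := by exact_mod_cast hn
    have h6 := dist_triangle4 (cycleRep hG hc s) (vtx hG (c.cyc (⌊s⌋ + 1)))
      (vtx hG (c.cyc ⌊t⌋)) (cycleRep hG hc t)
    rw [dist_vtx_vtx, dist_comm (vtx hG (c.cyc ⌊t⌋))] at h6
    linarith

theorem exists_le_dist_cycleRep_vtx (hc : c.IsCycle) (F : SimpleGraph.GateMap G {e | e ∈ c.edges}) (s : ℝ)
    (n : ℤ) : ∃ k : ℤ, |s - n + k * c.length| ≤ dist (cycleRep hG hc s) (vtx hG (c.cyc n)) := by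
  have hs := Int.floor_add_fract s
  have hs0 := Int.fract_nonneg s
  have hs1 := (Int.fract_lt_one s).le
  obtain ⟨k, hk⟩ := hc.exists_le_dist_cyc hG F ⌊s⌋ n
  obtain ⟨l, hl⟩ := hc.exists_le_dist_cyc hG F (⌊s⌋ + 1) n
  have hk' : |(⌊s⌋ - n + k * c.length : ℝ)| ≤ G.dist (c.cyc ⌊s⌋) (c.cyc n) := by exact_mod_cast hk
  have hl' : |(⌊s⌋ + 1 - n + l * c.length : ℝ)| ≤ G.dist (c.cyc (⌊s⌋ + 1)) (c.cyc n) := by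
    exact_mod_cast hl
  rw [abs_le] at hk' hl'
  rw [dist_vtx, distVertex, cycleRep]
  rcases min_choice (Int.fract s + G.dist (c.cyc ⌊s⌋) (c.cyc n) : ℝ)
    (1 - Int.fract s + G.dist (c.cyc (⌊s⌋ + 1)) (c.cyc n)) with h | h
  · refine ⟨k, ?_⟩
    rw [h, abs_le]
    constructor <;> linarith
  · refine ⟨l, ?_⟩
    rw [h, abs_le]
    constructor <;> linarith

theorem exists_le_dist_cycleRep (hc : c.IsCycle) (F : SimpleGraph.GateMap G {e | e ∈ c.edges}) (s t : ℝ) :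
    ∃ k : ℤ, |s - t + k * c.length| ≤ dist (cycleRep hG hc s) (cycleRep hG hc t) := by
  have hs := Int.floor_add_fract s
  have ht := Int.floor_add_fract t
  have ht0 := Int.fract_nonneg t
  have ht1 := (Int.fract_lt_one t).le
  have hL := hc.three_le_length
  obtain ⟨k, hk⟩ := exists_le_dist_cycleRep_vtx (hG := hG) hc F s ⌊t⌋
  obtain ⟨l, hl⟩ := exists_le_dist_cycleRep_vtx (hG := hG) hc F s (⌊t⌋ + 1)
  rw [dist_vtx] at hk hl
  rw [abs_le] at hk hl
  push_cast at hl
  have through : ∃ k : ℤ, |s - t + k * c.length| ≤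
      distThrough (cycleRep hG hc s) (cycleRep hG hc t) := by
    rcases min_choice ((cycleRep hG hc s).distVertex (c.cyc ⌊t⌋) + Int.fract t)
      ((cycleRep hG hc s).distVertex (c.cyc (⌊t⌋ + 1)) + (1 - Int.fract t)) with h | h
    · refine ⟨k, ?_⟩
      refine le_of_le_of_eq ?_ h.symm
      rw [abs_le]
      constructor <;> linarith
    · refine ⟨l, ?_⟩
      refine le_of_le_of_eq ?_ h.symm
      rw [abs_le]
      constructor <;> linarith
  rw [dist_def, pathDist]
  split_ifs with h1 h2
  · rcases min_choice |(cycleRep hG hc s).pos - (cycleRep hG hc t).pos|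
      (distThrough (cycleRep hG hc s) (cycleRep hG hc t)) with h | h
    · obtain ⟨m, hm⟩ := hc.exists_eq_of_cyc_eq h1.1
      refine ⟨-m, ?_⟩
      rw [h]
      have hm' : (⌊s⌋ : ℝ) = ⌊t⌋ + m * c.length := by exact_mod_cast hm
      refine le_of_eq (congrArg _ ?_)
      simp only [cycleRep]
      push_cast
      linarith
    · rwa [h]
  · obtain ⟨m, hm⟩ := hc.exists_eq_of_cyc_eq h2.1
    obtain ⟨n, hn⟩ := hc.exists_eq_of_cyc_eq h2.2
    exfalso
    have h2 : (n - m) * c.length = 2 := by linarith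
    have h3 : (c.length : ℤ) ∣ 2 := Dvd.intro_left _ h2
    have := Int.le_of_dvd (by norm_num) h3
    lia
  · exact through

/-- The parametrization of a cycle by arc length. -/
noncomputable def cycleMap (hG : G.Connected) (hc : c.IsCycle) (s : ℝ) : MetricGraph G hG :=
  SeparationQuotient.mk (cycleRep hG hc s)

theorem cycleMap_add_length (hc : c.IsCycle) (s : ℝ) :
    cycleMap hG hc (s + c.length) = cycleMap hG hc s := by
  have := cycleRep_add_mul (hG := hG) hc s 1
  rw [Int.cast_one, one_mul] at this
  rw [cycleMap, this, cycleMap]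

theorem dist_cycleMap_le (hc : c.IsCycle) (s t : ℝ) :
    dist (cycleMap hG hc s) (cycleMap hG hc t) ≤ |s - t| := by
  rw [cycleMap, cycleMap, SeparationQuotient.dist_mk]
  exact dist_cycleRep_le hc s t

theorem exists_le_dist_cycleMap (hc : c.IsCycle) (F : SimpleGraph.GateMap G {e | e ∈ c.edges}) (s t : ℝ) :
    ∃ k : ℤ, |s - t + k * c.length| ≤ dist (cycleMap hG hc s) (cycleMap hG hc t) := by
  rw [cycleMap, cycleMap, SeparationQuotient.dist_mk]
  exact exists_le_dist_cycleRep hc F s t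

theorem min_le_dist_cycleMap (hc : c.IsCycle) (F : SimpleGraph.GateMap G {e | e ∈ c.edges}) (s t : ℝ) :
    min |s - t| (c.length - |s - t|) ≤ dist (cycleMap hG hc s) (cycleMap hG hc t) := by
  obtain ⟨k, hk⟩ := exists_le_dist_cycleMap (hG := hG) hc F s t
  refine le_trans ?_ hk
  rcases eq_or_ne k 0 with rfl | h
  · simp
  · refine min_le_of_right_le ?_
    have h1 : (1 : ℝ) ≤ |(k : ℝ)| := by exact_mod_cast Int.one_le_abs h
    have h2 : |(k * c.length : ℝ)| = |(k : ℝ)| * c.length := by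
      rw [abs_mul, Nat.abs_cast]
    have h3 := abs_sub_abs_le_abs_sub (k * c.length : ℝ) (t - s)
    rw [h2, abs_sub_comm t s] at h3
    rw [show s - t + k * c.length = k * c.length - (t - s) by ring]
    have h4 : (c.length : ℝ) ≤ |(k : ℝ)| * c.length :=
      le_mul_of_one_le_left (Nat.cast_nonneg _) h1
    linarith

theorem mk_eq_cycleMap (hc : c.IsCycle) (p : Rep G hG) (hp : s(p.fst, p.snd) ∈ c.edges) :
    ∃ s, SeparationQuotient.mk p = cycleMap hG hc s := by
  have vert : ∀ n : ℤ, vertex hG (c.cyc n) = cycleMap hG hc n := by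
    intro n
    refine mk_eq_mk_of_dist ?_
    rw [dist_comm, dist_vtx]
    refine le_antisymm (min_le_of_left_le ?_) ?_
    · simp [cycleRep]
    · rw [← dist_vtx]
      exact dist_nonneg
  have h0 := p.pos_nonneg
  have h1 := p.pos_le_one
  have hadj := c.adj_of_mem_edges hp
  have e0 := p.dist_vtx_fst_le
  have e1 := p.dist_vtx_snd_le
  by_cases hp0 : p.pos = 0
  · have : SeparationQuotient.mk p = vertex hG p.fst :=
      mk_eq_mk_of_dist (le_antisymm (hp0 ▸ e0) dist_nonneg)
    obtain ⟨n, h | h⟩ := SimpleGraph.Walk.exists_cyc_of_mem_edges hp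
    · exact ⟨_, by rw [this, h.1, vert]⟩
    · exact ⟨_, by rw [this, h.1, vert]⟩
  by_cases hp1 : p.pos = 1
  · have : SeparationQuotient.mk p = vertex hG p.snd :=
      mk_eq_mk_of_dist (le_antisymm (by simpa [hp1] using e1) dist_nonneg)
    obtain ⟨n, h | h⟩ := SimpleGraph.Walk.exists_cyc_of_mem_edges hp
    · exact ⟨_, by rw [this, h.2, vert]⟩
    · exact ⟨_, by rw [this, h.2, vert]⟩
  have h0 := h0.lt_of_ne (Ne.symm hp0)
  have h1 := h1.lt_of_ne hp1
  obtain ⟨n, h | h⟩ := SimpleGraph.Walk.exists_cyc_of_mem_edges hp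
  · refine ⟨n + p.pos, mk_eq_mk_of_dist ?_⟩
    have e2 : ⌊(n + p.pos : ℝ)⌋ = n := by
      rw [Int.floor_eq_iff]
      constructor <;> linarith
    have e3 : Int.fract (n + p.pos : ℝ) = p.pos := by
      rw [Int.fract, e2]
      ring
    refine le_antisymm ?_ dist_nonneg
    simp [dist_def, pathDist, cycleRep, e2, e3, h]
  · refine ⟨n + (1 - p.pos), mk_eq_mk_of_dist ?_⟩
    have e2 : ⌊(n + (1 - p.pos) : ℝ)⌋ = n := by
      rw [Int.floor_eq_iff]
      constructor <;> linarith
    have e3 : Int.fract (n + (1 - p.pos) : ℝ) = 1 - p.pos := by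
      rw [Int.fract, e2]
      ring
    refine le_antisymm ?_ dist_nonneg
    have := (hc.adj_cyc n).ne
    simp [dist_def, pathDist, cycleRep, e2, e3, h, this]

theorem dist_mk_le_half_length (hc : c.IsCycle) (p q : Rep G hG)
    (hp : s(p.fst, p.snd) ∈ c.edges) (hq : s(q.fst, q.snd) ∈ c.edges) :
    dist (SeparationQuotient.mk p) (SeparationQuotient.mk q) ≤ c.length / 2 := by
  obtain ⟨s, hs⟩ := mk_eq_cycleMap hc p hp
  obtain ⟨t, ht⟩ := mk_eq_cycleMap hc q hq
  have hL : (0 : ℝ) < c.length := by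
    have := hc.three_le_length
    exact_mod_cast (by lia : 0 < c.length)
  obtain ⟨k, hk⟩ : ∃ k : ℤ, |s - t - k * c.length| ≤ c.length / 2 := by
    refine ⟨round ((s - t) / c.length), ?_⟩
    have h := abs_sub_round ((s - t) / c.length)
    have h2 : s - t - round ((s - t) / c.length) * c.length =
        ((s - t) / c.length - round ((s - t) / c.length)) * c.length := by
      field_simp
    rw [h2, abs_mul, abs_of_pos hL]
    nlinarith
  rw [hs, ht]
  have h1 : cycleMap hG hc t = cycleMap hG hc (t + k * c.length) := by
    rw [cycleMap, cycleMap, cycleRep_add_mul]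
  rw [h1]
  refine (dist_cycleMap_le hc _ _).trans ?_
  rwa [show s - (t + k * c.length) = s - t - k * c.length by ring]

end MetricGraph

namespace MetricGraph

variable {V : Type*} {G : SimpleGraph V} {hG : G.Connected}

open MetricGraph.Rep

section LowerBound

variable {v : V} {c : G.Walk v v}

theorem dist_cycleMap (hc : c.IsCycle) (F : SimpleGraph.GateMap G {e | e ∈ c.edges}) {s t : ℝ}
    (h : |s - t| ≤ c.length / 2) : dist (cycleMap hG hc s) (cycleMap hG hc t) = |s - t| := by
  refine le_antisymm (dist_cycleMap_le hc s t) ?_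
  refine le_trans (le_min le_rfl ?_) (min_le_dist_cycleMap hc F s t)
  linarith

theorem isGeodesicSegment_cycleMap (hc : c.IsCycle)
    (F : SimpleGraph.GateMap G {e | e ∈ c.edges}) (a : ℝ) :
    IsGeodesicSegment (cycleMap hG hc a) (cycleMap hG hc (a + c.length / 2))
      (cycleMap hG hc '' Set.Icc a (a + c.length / 2)) := by
  have hL : (0 : ℝ) ≤ c.length / 2 := by positivity
  have hd : dist (cycleMap hG hc a) (cycleMap hG hc (a + c.length / 2)) = c.length / 2 := by
    have h : |a - (a + c.length / 2)| = (c.length / 2 : ℝ) := by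
      rw [sub_add_cancel_left, abs_neg, abs_of_nonneg hL]
    rw [dist_cycleMap hc F h.le, h]
  refine ⟨fun s => cycleMap hG hc (a + s), by simp, by rw [hd], ?_, ?_⟩
  · rw [hd]
    intro s hs t ht
    have h : a + s - (a + t) = s - t := by ring
    rw [dist_cycleMap hc F, h]
    rw [h, abs_le]
    constructor <;> linarith [hs.1, hs.2, ht.1, ht.2]
  · rw [hd, ← Set.image_image (cycleMap hG hc) (fun s => a + s), Set.image_const_add_Icc, add_zero]

theorem isGeodesicSegment_singleton {X : Type*} [MetricSpace X] (x : X) :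
    IsGeodesicSegment x x {x} := by
  refine ⟨fun _ => x, rfl, rfl, ?_, by simp⟩
  intro s hs t ht
  simp only [dist_self, Set.Icc_self, Set.mem_singleton_iff] at hs ht ⊢
  simp [hs, ht]

theorem length_div_four_le_hyperbolicityConstant (hproper : G.HasProperCycles) (hc : c.IsCycle) :
    1 / 4 * (c.length : ℝ≥0∞) ≤ hyperbolicityConstant (MetricGraph G hG) := by
  obtain ⟨F⟩ := hproper.nonempty_gateMap hG hc
  have hL : (0 : ℝ) ≤ c.length := by positivity
  have hA := isGeodesicSegment_cycleMap (hG := hG) hc F 0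
  have hB := isGeodesicSegment_cycleMap (hG := hG) hc F (0 + c.length / 2)
  rw [add_assoc, add_halves, cycleMap_add_length] at hB
  refine le_trans ?_ (le_iSup_of_le _ <| le_iSup_of_le _ <| le_iSup_of_le _ <| le_iSup_of_le _ <|
    le_iSup_of_le _ <| le_iSup_of_le _ <| le_iSup_of_le hA <| le_iSup_of_le hB <|
    le_iSup_of_le (isGeodesicSegment_singleton _) le_rfl)
  refine le_iInf₂ fun δ hδ => ?_
  have hmid := hδ.1 ⟨c.length / 4, ⟨by linarith, by linarith⟩, rfl⟩
  rw [Metric.mem_cthickening_iff, ENNReal.ofReal_coe_nnreal] at hmid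
  refine le_trans ?_ hmid
  have h4 : (1 / 4 * (c.length : ℝ≥0∞)) = ENNReal.ofReal (c.length / 4) := by
    rw [div_eq_inv_mul, ENNReal.ofReal_mul (by norm_num), ENNReal.ofReal_inv_of_pos (by norm_num),
      ENNReal.ofReal_natCast, ENNReal.ofReal_ofNat, one_div]
  rw [h4]
  refine Metric.le_infEDist.mpr ?_
  have key : ∀ t : ℝ, c.length / 4 ≤ |c.length / 4 - t| → |c.length / 4 - t| ≤ 3 * c.length / 4 →
      ENNReal.ofReal (c.length / 4) ≤ edist (cycleMap hG hc (c.length / 4)) (cycleMap hG hc t) := by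
    intro t h1 h2
    rw [edist_dist]
    refine ENNReal.ofReal_le_ofReal (le_trans (le_min h1 ?_) (min_le_dist_cycleMap hc F _ _))
    linarith
  rintro y (⟨t, ht, rfl⟩ | rfl)
  · have : |c.length / 4 - t| = t - c.length / 4 := by
      rw [abs_sub_comm, abs_of_nonneg (by linarith [ht.1])]
    apply key <;> rw [this] <;> linarith [ht.1, ht.2]
  · have : |(c.length / 4 : ℝ) - 0| = c.length / 4 := by
      rw [sub_zero, abs_of_nonneg (by positivity)]
    apply key <;> rw [this]
    linarith

end LowerBound

section UpperBound

/-- The projections of the endpoints of a geodesic through an inner point of an edge of `K` lie on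
the geodesic, on both sides of that point, and on every connected set that contains the endpoints
but not the point. -/
theorem exists_proj_mem {K : Set (Sym2 V)} (F : SimpleGraph.GateMap G K) {γ : ℝ → MetricGraph G hG}
    {l t : ℝ} (hγ : ∀ s ∈ Set.Icc 0 l, ∀ t ∈ Set.Icc 0 l, dist (γ s) (γ t) = |s - t|)
    (ht : t ∈ Set.Icc 0 l) (hself : proj F (γ t) = γ t) (hvert : ∀ w, γ t ≠ vertex hG w)
    {S : Set (MetricGraph G hG)} (hS : IsPreconnected S) (h0 : γ 0 ∈ S) (hl : γ l ∈ S)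
    (hnot : γ t ∉ S) :
    ∃ t₁ ∈ Set.Icc 0 t, ∃ t₂ ∈ Set.Icc t l, γ t₁ = proj F (γ 0) ∧ γ t₂ = proj F (γ l) ∧
      γ t₁ ∈ S ∧ γ t₂ ∈ S := by
  have hcont : ContinuousOn γ (Set.Icc 0 l) :=
    (LipschitzOnWith.of_dist_le_mul (K := 1) fun s hs t ht => by
      rw [hγ s hs t ht, NNReal.coe_one, one_mul, Real.dist_eq]).continuousOn
  have sub1 : Set.Icc 0 t ⊆ Set.Icc 0 l := Set.Icc_subset_Icc_right ht.2
  have sub2 : Set.Icc t l ⊆ Set.Icc 0 l := Set.Icc_subset_Icc_left ht.1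
  have aux : ∀ T : Set (MetricGraph G hG), IsPreconnected T → ∀ x ∈ T, γ t ∈ T → proj F x ∈ T := by
    intro T hT x hx hp
    by_contra h
    exact h (by rwa [← proj_eq_of_proj_notMem F hT hx hp h, hself])
  obtain ⟨t₁, ht₁, e₁⟩ := aux _ (isPreconnected_Icc.image γ (hcont.mono sub1)) (γ 0)
    ⟨0, ⟨le_rfl, ht.1⟩, rfl⟩ ⟨t, ⟨ht.1, le_rfl⟩, rfl⟩
  obtain ⟨t₂, ht₂, e₂⟩ := aux _ (isPreconnected_Icc.image γ (hcont.mono sub2)) (γ l)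
    ⟨l, ⟨ht.2, le_rfl⟩, rfl⟩ ⟨t, ⟨le_rfl, ht.2⟩, rfl⟩
  have hne : proj F (γ 0) ≠ proj F (γ l) := by
    intro h
    have hd := hγ t₁ (sub1 ht₁) t₂ (sub2 ht₂)
    rw [e₁, e₂, h, dist_self, eq_comm, abs_eq_zero] at hd
    have htt : t₁ = t := le_antisymm ht₁.2 (by linarith [ht₂.1])
    rw [htt] at e₁
    have := proj_eq_self_of_forall_ne F (x := γ 0) fun w hw => hvert w (e₁.trans hw)
    exact hnot (by rwa [e₁, this])
  refine ⟨t₁, ht₁, t₂, ht₂, e₁, e₂, ?_, ?_⟩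
  · rw [e₁]
    by_contra h
    exact hne (proj_eq_of_proj_notMem F hS h0 hl h).symm
  · rw [e₂]
    by_contra h
    exact hne (proj_eq_of_proj_notMem F hS hl h0 h)

theorem exists_mk_eq_of_edge {u v : V} (p : Rep G hG) (h : G.Adj u v)
    (hp : s(p.fst, p.snd) = s(u, v)) :
    ∃ s hs, SeparationQuotient.mk p = SeparationQuotient.mk (⟨u, v, s, hs⟩ : Rep G hG) := by
  obtain ⟨a, b, s, hs⟩ := p
  rcases Sym2.eq_iff.mp hp with ⟨rfl, rfl⟩ | ⟨rfl, rfl⟩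
  · exact ⟨s, hs, rfl⟩
  · have h0 := Rep.pos_nonneg (⟨a, b, s, hs⟩ : Rep G hG)
    have h1 := Rep.pos_le_one (⟨a, b, s, hs⟩ : Rep G hG)
    refine ⟨1 - s, Or.inl ⟨h, by simpa using h1, by simpa using h0⟩, mk_eq_mk_of_dist ?_⟩
    refine le_antisymm ?_ dist_nonneg
    simp [dist_def, pathDist, h.ne]

theorem dist_vertex_of_edge {u v : V} {s : ℝ} (h : G.Adj u v)
    (hs : (G.Adj u v ∧ 0 ≤ s ∧ s ≤ 1) ∨ (u = v ∧ s = 0)) :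
    dist (SeparationQuotient.mk (⟨u, v, s, hs⟩ : Rep G hG)) (vertex hG u) = s := by
  have h1 := Rep.pos_le_one (⟨u, v, s, hs⟩ : Rep G hG)
  rw [vertex, SeparationQuotient.dist_mk, dist_vtx, distVertex,
    SimpleGraph.dist_eq_one_iff_adj.mpr h.symm]
  simp only [SimpleGraph.dist_self, Nat.cast_zero, Nat.cast_one, add_zero]
  exact min_eq_left (by linarith)

/-- A connected set that contains the endpoints of a geodesic contains its inner points of
bridges. -/
theorem mem_of_bridge {u v : V} (huv : G.Adj u v) (F : SimpleGraph.GateMap G {s(u, v)})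
    {γ : ℝ → MetricGraph G hG} {l t : ℝ}
    (hγ : ∀ s ∈ Set.Icc 0 l, ∀ t ∈ Set.Icc 0 l, dist (γ s) (γ t) = |s - t|)
    (ht : t ∈ Set.Icc 0 l) {p : Rep G hG} (hp : s(p.fst, p.snd) = s(u, v))
    (hpt : γ t = SeparationQuotient.mk p) (hvert : ∀ w, γ t ≠ vertex hG w)
    {S : Set (MetricGraph G hG)} (hS : IsPreconnected S) (h0 : γ 0 ∈ S) (hl : γ l ∈ S) :
    γ t ∈ S := by
  by_contra hnot
  have hself : proj F (γ t) = γ t := by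
    rw [hpt, proj_mk, retract_of_mem F hp]
  obtain ⟨t₁, ht₁, t₂, ht₂, e₁, e₂, m₁, m₂⟩ :=
    exists_proj_mem F hγ ht hself hvert hS h0 hl hnot
  have on_edge : ∀ x, ∃ s hs, proj F x = SeparationQuotient.mk (⟨u, v, s, hs⟩ : Rep G hG) := by
    intro x
    obtain ⟨q, hq, h⟩ := exists_proj_eq F x
    rw [h]
    exact exists_mk_eq_of_edge q huv hq
  obtain ⟨a, ha, ea⟩ := on_edge (γ 0)
  obtain ⟨b, hb, eb⟩ := on_edge (γ l)
  obtain ⟨s, hs, es⟩ := on_edge (γ t)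
  rw [hself] at es
  have d1 := hγ t₁ ⟨ht₁.1, ht₁.2.trans ht.2⟩ t ht
  have d2 := hγ t ht t₂ ⟨ht.1.trans ht₂.1, ht₂.2⟩
  have d3 := hγ t₁ ⟨ht₁.1, ht₁.2.trans ht.2⟩ t₂ ⟨ht.1.trans ht₂.1, ht₂.2⟩
  have ga : dist (proj F (γ t₁)) (vertex hG u) = a := by
    rw [e₁, proj_proj, ea, dist_vertex_of_edge huv]
  have gb : dist (proj F (γ t₂)) (vertex hG u) = b := by
    rw [e₂, proj_proj, eb, dist_vertex_of_edge huv]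
  rw [e₁, ea, es, SeparationQuotient.dist_mk, dist_eq_of_edge huv] at d1
  rw [e₂, eb, es, SeparationQuotient.dist_mk, dist_eq_of_edge huv] at d2
  rw [e₁, ea, e₂, eb, SeparationQuotient.dist_mk, dist_eq_of_edge huv] at d3
  have hmem : s ∈ Set.uIcc a b := by
    have h1 := ht₁.2
    have h2 := ht₂.1
    rw [Set.mem_uIcc]
    grind
  have hconn := (hS.image (fun z => dist (proj F z) (vertex hG u))
    ((continuous_proj F).dist continuous_const).continuousOn).ordConnected
  obtain ⟨z, hz, hzs⟩ := hconn.uIcc_subset ⟨_, m₁, ga⟩ ⟨_, m₂, gb⟩ hmem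
  obtain ⟨s', hs', ez⟩ := on_edge z
  simp only [ez, dist_vertex_of_edge huv] at hzs
  subst hzs
  have hzt : proj F z = γ t := ez.trans es.symm
  have := proj_eq_self_of_forall_ne F (x := z) fun w hw => hvert w (hzt.symm.trans hw)
  exact hnot (by rwa [← hzt, this])

theorem mem_cthickening_of_inner (hproper : G.HasProperCycles) {δ : ℝ≥0}
    (hδ : ∀ (v : V) (c : G.Walk v v), c.IsCycle → (c.length : ℝ) ≤ 4 * δ)
    {γ : ℝ → MetricGraph G hG} {l t : ℝ}
    (hγ : ∀ s ∈ Set.Icc 0 l, ∀ t ∈ Set.Icc 0 l, dist (γ s) (γ t) = |s - t|)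
    (ht : t ∈ Set.Icc 0 l) (hvert : ∀ w, γ t ≠ vertex hG w)
    {S : Set (MetricGraph G hG)} (hS : IsPreconnected S) (h0 : γ 0 ∈ S) (hl : γ l ∈ S) :
    γ t ∈ Metric.cthickening δ S := by
  by_cases hnot : γ t ∈ S
  · exact Metric.self_subset_cthickening S hnot
  obtain ⟨p, hp⟩ := SeparationQuotient.surjective_mk (γ t)
  have hadj : G.Adj p.fst p.snd := by
    rcases p.valid with h | h
    · exact h.1
    · exfalso
      refine hvert p.fst (hp.symm.trans (mk_eq_mk_of_dist (le_antisymm ?_ dist_nonneg)))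
      exact p.dist_vtx_fst_le.trans h.2.le
  by_cases hcyc : ∃ (w : V) (c : G.Walk w w), c.IsCycle ∧ s(p.fst, p.snd) ∈ c.edges
  · obtain ⟨w, c, hc, hpc⟩ := hcyc
    obtain ⟨F⟩ := hproper.nonempty_gateMap hG hc
    have hself : proj F (γ t) = γ t := by
      rw [← hp, proj_mk, retract_of_mem F hpc]
    obtain ⟨t₁, ht₁, t₂, ht₂, e₁, e₂, m₁, m₂⟩ :=
      exists_proj_mem F hγ ht hself hvert hS h0 hl hnot
    have hd : dist (γ t₁) (γ t₂) ≤ c.length / 2 := by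
      obtain ⟨q₁, hq₁, h₁⟩ := exists_proj_eq F (γ 0)
      obtain ⟨q₂, hq₂, h₂⟩ := exists_proj_eq F (γ l)
      rw [e₁, e₂, h₁, h₂]
      exact dist_mk_le_half_length hc q₁ q₂ hq₁ hq₂
    have i₁ : t₁ ∈ Set.Icc 0 l := ⟨ht₁.1, ht₁.2.trans ht.2⟩
    have i₂ : t₂ ∈ Set.Icc 0 l := ⟨ht.1.trans ht₂.1, ht₂.2⟩
    rw [hγ t₁ i₁ t₂ i₂, abs_le] at hd
    have hcδ := hδ w c hc
    rcases le_total (t - t₁) (t₂ - t) with h | h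
    · refine Metric.mem_cthickening_of_dist_le _ _ _ _ m₁ ?_
      rw [hγ t ht t₁ i₁, abs_of_nonneg (by linarith [ht₁.2])]
      linarith
    · refine Metric.mem_cthickening_of_dist_le _ _ _ _ m₂ ?_
      rw [hγ t ht t₂ i₂, abs_sub_comm, abs_of_nonneg (by linarith [ht₂.1])]
      linarith
  · push Not at hcyc
    obtain ⟨F⟩ := SimpleGraph.nonempty_gateMap_singleton hG hadj hcyc
    exact absurd (mem_of_bridge hadj F hγ ht rfl hp.symm hvert hS h0 hl) hnot

/-- A geodesic is in the vertices of the graph only at countably many times. -/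
theorem countable_setOf_eq_vertex {γ : ℝ → MetricGraph G hG} {l : ℝ}
    (hγ : ∀ s ∈ Set.Icc 0 l, ∀ t ∈ Set.Icc 0 l, dist (γ s) (γ t) = |s - t|) :
    {t | t ∈ Set.Icc 0 l ∧ ∃ w, γ t = vertex hG w}.Countable := by
  rcases Set.eq_empty_or_nonempty {t | t ∈ Set.Icc 0 l ∧ ∃ w, γ t = vertex hG w} with h | h
  · rw [h]
    exact Set.countable_empty
  obtain ⟨t₀, h₀, w₀, e₀⟩ := h
  refine (Set.countable_range fun n : ℤ => t₀ + n).mono ?_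
  rintro t ⟨ht, w, e⟩
  have h := hγ t ht t₀ h₀
  rw [e, e₀, dist_vertex] at h
  rcases abs_choice (t - t₀) with h' | h'
  · exact ⟨G.dist w w₀, by push_cast; linarith⟩
  · exact ⟨-G.dist w w₀, by push_cast; linarith⟩

theorem segment_subset_cthickening (hproper : G.HasProperCycles) {δ : ℝ≥0}
    (hδ : ∀ (v : V) (c : G.Walk v v), c.IsCycle → (c.length : ℝ) ≤ 4 * δ)
    {x y : MetricGraph G hG} {A S : Set (MetricGraph G hG)} (hA : IsGeodesicSegment x y A)
    (hS : IsPreconnected S) (hx : x ∈ S) (hy : y ∈ S) :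
    A ⊆ Metric.cthickening δ S := by
  obtain ⟨γ, h0, hl, hγ, rfl⟩ := hA
  rw [← h0] at hx
  rw [← hl] at hy
  generalize dist x y = l at *
  have hcont : ContinuousOn γ (Set.Icc 0 l) :=
    (LipschitzOnWith.of_dist_le_mul (K := 1) fun s hs t ht => by
      rw [hγ s hs t ht, NNReal.coe_one, one_mul, Real.dist_eq]).continuousOn
  rcases le_or_gt l 0 with hl0 | hl0
  · rintro _ ⟨t, ht, rfl⟩
    have : t = 0 := le_antisymm (ht.2.trans hl0) ht.1
    exact Metric.self_subset_cthickening S (this ▸ hx)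
  have hclosed : IsClosed (Set.Icc 0 l ∩ γ ⁻¹' Metric.cthickening δ S) :=
    hcont.preimage_isClosed_of_isClosed isClosed_Icc Metric.isClosed_cthickening
  have hdense := (countable_setOf_eq_vertex hγ).dense_compl ℝ
  have hsub : Set.Icc 0 l ⊆ Set.Icc 0 l ∩ γ ⁻¹' Metric.cthickening δ S := by
    rw [← closure_Ioo hl0.ne]
    nth_rewrite 2 [closure_Ioo hl0.ne]
    refine hclosed.closure_subset_iff.mpr ((hdense.open_subset_closure_inter isOpen_Ioo).trans
      (hclosed.closure_subset_iff.mpr ?_))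
    rintro t ⟨ht, hv⟩
    have ht' := Set.Ioo_subset_Icc_self ht
    exact ⟨ht', mem_cthickening_of_inner hproper hδ hγ ht' (fun w hw => hv ⟨ht', w, hw⟩) hS hx hy⟩
  rintro _ ⟨t, ht, rfl⟩
  exact (hsub ht).2

theorem _root_.IsGeodesicSegment.mem_and_isPreconnected {X : Type*} [MetricSpace X] {x y : X}
    {A : Set X} (h : IsGeodesicSegment x y A) : x ∈ A ∧ y ∈ A ∧ IsPreconnected A := by
  obtain ⟨γ, h0, hl, hγ, rfl⟩ := h
  refine ⟨⟨0, ⟨le_rfl, dist_nonneg⟩, h0⟩, ⟨_, ⟨dist_nonneg, le_rfl⟩, hl⟩, ?_⟩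
  exact isPreconnected_Icc.image γ
    (LipschitzOnWith.of_dist_le_mul (K := 1) fun s hs t ht => by
      rw [hγ s hs t ht, NNReal.coe_one, one_mul, Real.dist_eq]).continuousOn

theorem hyperbolicityConstant_le (hproper : G.HasProperCycles) :
    hyperbolicityConstant (MetricGraph G hG) ≤ 1 / 4 * G.circumference := by
  rcases eq_or_ne G.circumference ⊤ with htop | htop
  · rw [htop, ENNReal.mul_top (by simp)]
    exact le_top
  obtain ⟨κ, hκ⟩ : ∃ κ : ℝ≥0, (κ : ℝ≥0∞) = G.circumference :=
    ⟨_, ENNReal.coe_toNNReal htop⟩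
  have hδ : ∀ (v : V) (c : G.Walk v v), c.IsCycle → (c.length : ℝ) ≤ 4 * (κ / 4 : ℝ≥0) := by
    intro v c hc
    have h : (c.length : ℝ≥0∞) ≤ κ := by
      rw [hκ]
      exact le_iSup_of_le v (le_iSup_of_le c (le_iSup_of_le hc le_rfl))
    have h' : (c.length : ℝ≥0) ≤ κ := by exact_mod_cast h
    have h'' : (c.length : ℝ) ≤ κ := by exact_mod_cast h'
    push_cast
    linarith
  have hκ' : 1 / 4 * G.circumference = ((κ / 4 : ℝ≥0) : ℝ≥0∞) := by
    rw [← hκ, ENNReal.coe_div (by norm_num), one_div, ENNReal.div_eq_inv_mul]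
    rfl
  rw [hκ']
  refine iSup_le fun x => iSup_le fun y => iSup_le fun z => iSup_le fun A => iSup_le fun B =>
    iSup_le fun C => iSup_le fun hA => iSup_le fun hB => iSup_le fun hC => iInf₂_le _ ?_
  obtain ⟨xA, yA, cA⟩ := hA.mem_and_isPreconnected
  obtain ⟨yB, zB, cB⟩ := hB.mem_and_isPreconnected
  obtain ⟨zC, xC, cC⟩ := hC.mem_and_isPreconnected
  exact ⟨segment_subset_cthickening hproper hδ hA (cB.union z zB zC cC) (Or.inr xC) (Or.inl yB),
    segment_subset_cthickening hproper hδ hB (cC.union x xC xA cA) (Or.inr yA) (Or.inl zC),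
    segment_subset_cthickening hproper hδ hC (cA.union y yA yB cB) (Or.inr zB) (Or.inl xA)⟩

end UpperBound

end MetricGraph

theorem proposition2p14 {V : Type*} (G : SimpleGraph V) (hG : G.Connected)
    (hproper : G.HasProperCycles) :
    hyperbolicityConstant (MetricGraph G hG) = 1 / 4 * G.circumference := by
  refine le_antisymm (MetricGraph.hyperbolicityConstant_le hproper) ?_
  simp only [SimpleGraph.circumference, ENNReal.mul_iSup]
  exact iSup_le fun v => iSup_le fun c => iSup_le fun hc =>
    MetricGraph.length_div_four_le_hyperbolicityConstant hproper hc
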